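/- Let $q$ be a complex number with $0<|q|<1$; write $q=e^{2\pi i\tau}$ with $\operatorname{Im}\tau>0$ and put $q^x:=e^{2\pi i\tau x}$ for real $x$. Let $(q)_\infty:=\prod_{i\ge 1}(1-q^i)$. Let $\operatorname{sg}(r):=1$ for integers $r\ge 0$, $\operatorname{sg}(r):=-1$ for $r<0$, and $\operatorname{sg}(r,s):=\frac{\operatorname{sg}(r)+\operatorname{sg}(s)}{2}$. For a fixed integer $t\ge 2$ and $p,m\in\mathbb Z$ define $$\theta_{p,m}:=\sum_{\substack{r,s\in\mathbb Z\\ r\equiv s \ (\mathrm{mod}\ 2)}}\operatorname{sg}(r,s)(-1)^{\frac{r-s}{2}}q^{B_{p,m}(r,s)},\qquad \theta^*_{p,m}:=q^{C_{p,m}}\theta_{p,m},$$ where $$B_{p,m}(r,s):=\frac{r^2}{8}+\frac{4t-1}{4}rs+\frac{s^2}{8}+\frac{4p-1-2m}{4}r+\frac{1+2m}{4}s,\qquad C_{p,m}:=\frac{-2p^2-t(2m+1)(2m+1-4p)}{8t(2t-1)}.$$ Then for all integers $t\ge 2$, $1\le m<t$ and $l\in\mathbb Z$, all the infinite series below (including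 those defining $\theta^*_{t+k,m+k}$) converge absolutely, and $$\sum_{k=0}^{2t-1}(-1)^k\,\theta^*_{t+k,m+k}\sum_{\substack{r\in\mathbb Z\\ r\equiv 2tl+(2t-1)k\ (\mathrm{mod}\ 2t(2t-1))}}q^{\frac{r^2}{4t(2t-1)}}=\begin{cases}(-1)^m q^{1/8}(q)_\infty^3 & \text{if } l\equiv m \pmod{2t-1},\\ (-1)^{m+1}q^{1/8}(q)_\infty^3 & \text{if } l\equiv -m\pmod{2t-1},\\ 0&\text{otherwise.}\end{cases}$$ -/

import Mathlib

/-- The power `q ^ x` for a real exponent `x`, where `q = exp (2 π i τ)`: it is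
`exp (2 π i τ x)`, so that `q ^ (x + y) = q ^ x * q ^ y` for all real `x`, `y`. Every `q ≠ 0` with
`‖q‖ < 1` arises from some `τ` in the upper half-plane. -/
noncomputable def qPow (τ : ℂ) (x : ℝ) : ℂ :=
  Complex.exp (2 * (Real.pi : ℂ) * Complex.I * τ * (x : ℂ))

/-- The infinite `q`-Pochhammer symbol `(x; q)_∞ = ∏_{i ≥ 0} (1 - x q ^ i)`. -/
noncomputable def qPochInf (x q : ℂ) : ℂ := ∏' i : ℕ, (1 - x * q ^ i)

/-- The sign of an integer, with the convention that the sign of `0` is `1`. -/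
def sg (r : ℤ) : ℤ := if 0 ≤ r then 1 else -1

/-- `sg (r, s) = (sg r + sg s) / 2`. -/
noncomputable def sgPair (r s : ℤ) : ℂ := ((sg r : ℂ) + (sg s : ℂ)) / 2

/-- The exponent `B_{p,m}(r,s)`, for a given `t`. -/
noncomputable def Bexp (t : ℕ) (p m r s : ℤ) : ℝ :=
  (r : ℝ) ^ 2 / 8 + (4 * (t : ℝ) - 1) / 4 * (r : ℝ) * (s : ℝ) + (s : ℝ) ^ 2 / 8
    + (4 * (p : ℝ) - 1 - 2 * (m : ℝ)) / 4 * (r : ℝ) + (1 + 2 * (m : ℝ)) / 4 * (s : ℝ)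

/-- The exponent `C_{p,m}`, for a given `t`. -/
noncomputable def Cexp (t : ℕ) (p m : ℤ) : ℝ :=
  (-2 * (p : ℝ) ^ 2 - (t : ℝ) * (2 * (m : ℝ) + 1) * (2 * (m : ℝ) + 1 - 4 * (p : ℝ)))
    / (8 * (t : ℝ) * (2 * (t : ℝ) - 1))

/-- The term of the indefinite binary theta series at `(r, s)`. It is used only for
`r ≡ s (mod 2)`, where the integer division `(r - s) / 2` is exact. -/
noncomputable def thetaTerm (τ : ℂ) (t : ℕ) (p m r s : ℤ) : ℂ :=
  sgPair r s * (-1 : ℂ) ^ ((r - s) / 2) * qPow τ (Bexp t p m r s)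

/-- The indefinite binary theta series `θ_{p,m}`, for a given `t`. -/
noncomputable def theta (τ : ℂ) (t : ℕ) (p m : ℤ) : ℂ :=
  ∑' x : {x : ℤ × ℤ // x.1 ≡ x.2 [ZMOD 2]}, thetaTerm τ t p m x.1.1 x.1.2

/-- The normalized series `θ*_{p,m} = q ^ C_{p,m} θ_{p,m}`, for a given `t`. -/
noncomputable def thetaStar (τ : ℂ) (t : ℕ) (p m : ℤ) : ℂ :=
  qPow τ (Cexp t p m) * theta τ t p m

/-- The term `q ^ (r ^ 2 / (4 t (2 t - 1)))`. -/
noncomputable def unaryTerm (τ : ℂ) (t : ℕ) (r : ℤ) : ℂ :=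
  qPow τ ((r : ℝ) ^ 2 / (4 * (t : ℝ) * (2 * (t : ℝ) - 1)))

/-- The unary theta series `∑ q ^ (r ^ 2 / (4 t (2 t - 1)))` over all integers `r` with
`r ≡ a (mod 2 t (2 t - 1))`. -/
noncomputable def unaryTheta (τ : ℂ) (t : ℕ) (a : ℤ) : ℂ :=
  ∑' r : {r : ℤ // r ≡ a [ZMOD 2 * (t : ℤ) * (2 * (t : ℤ) - 1)]}, unaryTerm τ t r.1

/-! Put r = u + v, s = u - v in the indefinite theta series and let n index the residue class of the
unary one. With N = k + 2tu, d = n - u and e = l + (2t-1)d, division with remainder merges k and u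
into one free integer N. The total exponent becomes (N+e)(N+e+1)/2 plus a part in e and v only
(`thetaTerm_mul_unaryTerm`), and the sign selects N ≥ 2t|v| or N < -2t|v| (`sgPair_add_sub`).

Summing over N first therefore leaves two tails T(2t|v| + e) + T(2t|v| - e) of the series ∑ (-1)^n
q^(n(n+1)/2). That series has sum 0 and is odd under n ↦ -1-n, so T is even (`altTail_neg`) and |v|
may be replaced by v.

The remaining exponent in (e, v) is, up to the constant 1/8, a product of two affine factors. Taking
the argument n of T as a coordinate, together with w = d ± v, makes one factor depend on w alone, so
the inner sums are ∑ q^(-h(w)n) T(n) with h affine. They vanish for h(w) ≠ 0; for h(w) = 0 summation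
by parts and Jacobi's identity give (q)_∞^3. The equation h(w) = 0 is solvable exactly when 2t-1
divides l + m, respectively m - l. -/

/-! ### Powers of q and Gaussian summability -/

lemma qPow_add (τ : ℂ) (x y : ℝ) : qPow τ (x + y) = qPow τ x * qPow τ y := by
  simp only [qPow, ← Complex.exp_add]
  congr 1
  push_cast
  ring

lemma qPow_zero (τ : ℂ) : qPow τ 0 = 1 := by simp [qPow]

lemma qPow_natCast (τ : ℂ) (n : ℕ) : qPow τ n = qPow τ 1 ^ n := by
  simp only [qPow, ← Complex.exp_nat_mul]
  congr 1
  push_cast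
  ring

lemma norm_qPow (τ : ℂ) (x : ℝ) : ‖qPow τ x‖ = Real.exp (-(2 * Real.pi * τ.im * x)) := by
  rw [qPow, Complex.norm_exp]
  congr 1
  simp [Complex.mul_re, Complex.mul_im]

lemma norm_qPow_le {τ : ℂ} (hτ : 0 < τ.im) {x y : ℝ} (h : x ≤ y) : ‖qPow τ y‖ ≤ ‖qPow τ x‖ := by
  rw [norm_qPow, norm_qPow, Real.exp_le_exp]
  have := Real.pi_pos
  have : 0 ≤ 2 * Real.pi * τ.im := by positivity
  nlinarith

lemma norm_qPow_one_lt_one {τ : ℂ} (hτ : 0 < τ.im) : ‖qPow τ 1‖ < 1 := by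
  rw [norm_qPow, Real.exp_lt_one_iff]
  have := Real.pi_pos
  have : 0 < 2 * Real.pi * τ.im := by positivity
  linarith

/-- Gaussian sums over `ℤ` with polynomial weights converge absolutely. -/
lemma summable_pow_mul_norm_qPow_quadratic {τ : ℂ} (hτ : 0 < τ.im) {a : ℝ} (ha : 0 < a) (b c : ℝ)
    (j : ℕ) :
    Summable fun n : ℤ => |(n : ℝ)| ^ j * ‖qPow τ (a * (n : ℝ) ^ 2 + b * n + c)‖ := by
  have h := (summable_pow_mul_jacobiTheta₂_term_bound (τ.im * |b|) (T := 2 * τ.im * a)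
    (by positivity) j).mul_left (Real.exp (-(2 * Real.pi * τ.im * c)))
  refine h.of_nonneg_of_le (fun n => by positivity) fun n => ?_
  push_cast
  rw [norm_qPow, mul_left_comm, ← Real.exp_add]
  gcongr
  have h1 : 0 ≤ 2 * Real.pi * τ.im := by have := Real.pi_pos; positivity
  have h2 : -(b * n) ≤ |b| * |(n : ℝ)| := by rw [← abs_mul]; exact neg_le_abs _
  nlinarith [mul_le_mul_of_nonneg_left h2 h1]

lemma summable_norm_qPow_quadratic {τ : ℂ} (hτ : 0 < τ.im) {a : ℝ} (ha : 0 < a) (b c : ℝ) :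
    Summable fun n : ℤ => ‖qPow τ (a * (n : ℝ) ^ 2 + b * n + c)‖ := by
  simpa using summable_pow_mul_norm_qPow_quadratic hτ ha b c 0

lemma norm_negOnePow (n : ℤ) : ‖(-1 : ℂ) ^ n‖ = 1 := by simp [norm_zpow]

lemma negOnePow_congr {a b : ℤ} (h : a ≡ b [ZMOD 2]) : (-1 : ℂ) ^ a = (-1 : ℂ) ^ b := by
  obtain ⟨c, hc⟩ := h.dvd
  obtain rfl : b = a + 2 * c := by linarith
  rw [zpow_add₀ (by simp), zpow_mul]
  simp

/-! ### The alternating theta series and its tails -/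

/-- The term `(-1) ^ n q ^ (n (n + 1) / 2)` of the alternating theta series. -/
noncomputable def altTerm (τ : ℂ) (n : ℤ) : ℂ :=
  (-1 : ℂ) ^ n * qPow τ ((n : ℝ) * (n + 1) / 2)

lemma norm_altTerm (τ : ℂ) (n : ℤ) : ‖altTerm τ n‖ = ‖qPow τ ((n : ℝ) * (n + 1) / 2)‖ := by
  rw [altTerm, norm_mul, norm_negOnePow, one_mul]

lemma altTerm_reflect (τ : ℂ) (n : ℤ) : altTerm τ (-1 - n) = -altTerm τ n := by
  have h : (-1 : ℂ) ^ (-1 - n) = -(-1 : ℂ) ^ n := by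
    rw [negOnePow_congr (b := n + 1) (Int.modEq_iff_dvd.2 ⟨n + 1, by ring⟩), zpow_add₀ (by simp)]
    simp
  rw [altTerm, altTerm, h, neg_mul]
  congr 3
  push_cast
  ring

lemma summable_pow_mul_norm_altTerm {τ : ℂ} (hτ : 0 < τ.im) (j : ℕ) :
    Summable fun n : ℤ => |(n : ℝ)| ^ j * ‖altTerm τ n‖ := by
  convert summable_pow_mul_norm_qPow_quadratic hτ (a := 1 / 2) (by norm_num) (1 / 2) 0 j using 3
    with n
  rw [norm_altTerm]
  congr 2
  ring

lemma summable_norm_altTerm {τ : ℂ} (hτ : 0 < τ.im) : Summable fun n : ℤ => ‖altTerm τ n‖ := by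
  simpa using summable_pow_mul_norm_altTerm hτ 0

lemma summable_altTerm {τ : ℂ} (hτ : 0 < τ.im) : Summable (altTerm τ) :=
  (summable_norm_altTerm hτ).of_norm

lemma summable_altTerm_add {τ : ℂ} (hτ : 0 < τ.im) (a : ℤ) :
    Summable fun j : ℕ => altTerm τ (a + j) :=
  (summable_altTerm hτ).comp_injective (i := fun j : ℕ => a + (j : ℤ)) fun x y h => by simpa using h

/-- The tail `∑_{n ≥ a} (-1) ^ n q ^ (n (n + 1) / 2)` of the alternating theta series. -/
noncomputable def altTail (τ : ℂ) (a : ℤ) : ℂ := ∑' j : ℕ, altTerm τ (a + j)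

/-- `q ^ (h n)` twists the alternating theta series into a vanishing series. -/
lemma tsum_qPow_mul_altTerm (τ : ℂ) (h : ℤ) :
    ∑' n : ℤ, qPow τ (-(h * n)) * altTerm τ n = 0 := by
  -- The exponent n(n+1)/2 - hn is symmetric about n = h - 1/2, and this reflection changes the
  -- parity of n, so the sum equals its own negative.
  have key : ∀ n : ℤ, qPow τ (-(h * (2 * h - 1 - n : ℤ))) * altTerm τ (2 * h - 1 - n) =
      -(qPow τ (-(h * n)) * altTerm τ n) := by
    intro n
    have hs : (-1 : ℂ) ^ (2 * h - 1 - n) = -(-1 : ℂ) ^ n := by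
      rw [negOnePow_congr (b := n + 1) (Int.modEq_iff_dvd.2 ⟨n + 1 - h, by ring⟩),
        zpow_add₀ (by simp)]
      simp
    rw [altTerm, altTerm, hs, mul_left_comm, mul_left_comm (qPow τ (-(h * n))), neg_mul,
      ← qPow_add, ← qPow_add]
    congr 3
    push_cast
    ring
  have h1 := (Equiv.subLeft (2 * h - 1)).tsum_eq fun n : ℤ => qPow τ (-(h * n)) * altTerm τ n
  simp only [Equiv.subLeft_apply, key, tsum_neg] at h1
  exact self_eq_neg.1 h1.symm

lemma tsum_altTerm (τ : ℂ) : ∑' n : ℤ, altTerm τ n = 0 := by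
  simpa [qPow_zero] using tsum_qPow_mul_altTerm τ 0

lemma tsum_altTerm_below (τ : ℂ) (a : ℤ) :
    ∑' j : ℕ, altTerm τ (a - 1 - j) = -altTail τ (-a) := by
  rw [altTail, ← tsum_neg]
  refine tsum_congr fun j => ?_
  rw [← altTerm_reflect]
  congr 1
  ring

/-- The full series is 0, and its part below a reflects under n ↦ -1-n to minus the tail from -a. -/
lemma altTail_neg {τ : ℂ} (hτ : 0 < τ.im) (a : ℤ) : altTail τ (-a) = altTail τ a := by
  have h1 : HasSum (fun n : ℤ => altTerm τ (a + n)) 0 := by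
    rw [← tsum_altTerm τ]
    exact (Equiv.addLeft a).hasSum_iff.2 (summable_altTerm hτ).hasSum
  have h2 := HasSum.of_nat_of_neg_add_one (f := fun n : ℤ => altTerm τ (a + n))
    (summable_altTerm_add hτ a).hasSum
    ((h1.summable.comp_injective (i := fun j : ℕ => -((j : ℤ) + 1))
      fun x y h => by simpa using h).hasSum)
  have h3 := h1.unique h2
  simp only [Function.comp_def] at h3
  have h4 := tsum_altTerm_below τ a
  have h5 : ∀ j : ℕ, a + -((j : ℤ) + 1) = a - 1 - j := fun j => by ring
  simp only [h5, h4] at h3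
  rw [altTail, altTail] at *
  linear_combination h3

lemma altTail_sub_altTail_add_one {τ : ℂ} (hτ : 0 < τ.im) (a : ℤ) :
    altTail τ a - altTail τ (a + 1) = altTerm τ a := by
  rw [altTail, (summable_altTerm_add hτ a).tsum_eq_zero_add, altTail]
  simp only [Nat.cast_zero, add_zero, Nat.cast_add, Nat.cast_one, add_assoc, add_comm (1 : ℤ)]
  ring

/-- The exponent at n + j is the sum of those at n and j plus nj ≥ 0. Tails thus decay like their
first term. -/
lemma norm_altTail_natCast_le {τ : ℂ} (hτ : 0 < τ.im) (n : ℕ) :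
    ‖altTail τ n‖ ≤ ‖altTerm τ n‖ * ∑' j : ℕ, ‖altTerm τ j‖ := by
  have hs : Summable fun j : ℕ => ‖altTerm τ j‖ :=
    (summable_norm_altTerm hτ).comp_injective (i := fun j : ℕ => (j : ℤ)) Nat.cast_injective
  rw [← tsum_mul_left]
  refine tsum_of_norm_bounded (hs.mul_left _).hasSum fun j => ?_
  simp only [norm_altTerm]
  rw [← norm_mul, ← qPow_add]
  refine norm_qPow_le hτ ?_
  push_cast
  have : (0 : ℝ) ≤ n * j := by positivity
  nlinarith

lemma summable_pow_mul_altTail {τ : ℂ} (hτ : 0 < τ.im) (k : ℕ) :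
    Summable fun n : ℤ => (n : ℂ) ^ k * altTail τ n := by
  have h : Summable fun n : ℕ => |(n : ℝ)| ^ k * ‖altTerm τ n‖ :=
    (summable_pow_mul_norm_altTerm hτ k).comp_injective (i := fun j : ℕ => (j : ℤ))
      Nat.cast_injective
  have h1 : Summable fun n : ℕ => |(n : ℝ)| ^ k * ‖altTail τ n‖ := by
    refine (h.mul_right (∑' j : ℕ, ‖altTerm τ j‖)).of_nonneg_of_le (fun n => by positivity)
      fun n => ?_
    rw [mul_assoc]
    gcongr
    exact norm_altTail_natCast_le hτ n
  refine Summable.of_norm (Summable.of_nat_of_neg ?_ ?_)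
  · refine h1.congr fun n => ?_
    simp [norm_pow]
  · refine h1.congr fun n => ?_
    simp [norm_pow, altTail_neg hτ]

/-- The twisted sums of the tails vanish, by summation by parts. -/
lemma tsum_qPow_mul_altTail_of_ne_zero {τ : ℂ} (hτ : 0 < τ.im) {h : ℤ} (hh : h ≠ 0) :
    ∑' n : ℤ, qPow τ (-(h * n)) * altTail τ n = 0 := by
  by_cases hs : Summable fun n : ℤ => qPow τ (-(h * n)) * altTail τ n
  swap
  -- Here `tsum` is 0 by default, so convergence of the twisted sum need not be proved.
  · exact tsum_eq_zero_of_not_summable hs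
  set S := ∑' n : ℤ, qPow τ (-(h * n)) * altTail τ n with hS
  have h1 : HasSum (fun n : ℤ => qPow τ (-(h * (n + 1 : ℤ))) * altTail τ (n + 1)) S :=
    (Equiv.addRight (1 : ℤ)).hasSum_iff.2 hs.hasSum
  have h2 := (hs.hasSum.sub (h1.mul_left (qPow τ h))).tsum_eq
  have h3 : ∀ n : ℤ, qPow τ (-(h * n)) * altTail τ n -
      qPow τ h * (qPow τ (-(h * (n + 1 : ℤ))) * altTail τ (n + 1)) =
      qPow τ (-(h * n)) * altTerm τ n := by
    intro n
    rw [← altTail_sub_altTail_add_one hτ n, ← mul_assoc, ← qPow_add]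
    rw [show (h : ℝ) + -(h * (n + 1 : ℤ)) = -(h * n) by push_cast; ring]
    ring
  simp only [h3, tsum_qPow_mul_altTerm] at h2
  have h4 : qPow τ h ≠ 1 := by
    intro h5
    have h6 := norm_qPow τ h
    rw [h5, norm_one, eq_comm, Real.exp_eq_one_iff] at h6
    have := Real.pi_pos
    have : (h : ℝ) ≠ 0 := by exact_mod_cast hh
    have h7 : 2 * Real.pi * τ.im * h ≠ 0 := by positivity
    exact h7 (neg_eq_zero.1 h6)
  have h5 : (1 - qPow τ h) * S = 0 := by rw [h2]; ring
  exact (mul_eq_zero.1 h5).resolve_left (sub_ne_zero.2 h4.symm)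

/-- Abel summation: n T(n) - (n+1) T(n+1) + T(n+1) = n (T(n) - T(n+1)), and the first two terms
telescope to 0. -/
lemma tsum_altTail {τ : ℂ} (hτ : 0 < τ.im) :
    ∑' n : ℤ, altTail τ n = ∑' n : ℤ, (n : ℂ) * altTerm τ n := by
  have hs : Summable fun n : ℤ => (n : ℂ) * altTail τ n := by
    simpa using summable_pow_mul_altTail hτ 1
  have hs0 : Summable fun n : ℤ => altTail τ n := by simpa using summable_pow_mul_altTail hτ 0
  have h1 := (Equiv.addRight (1 : ℤ)).hasSum_iff.2 hs.hasSum
  have h0 := (Equiv.addRight (1 : ℤ)).hasSum_iff.2 hs0.hasSum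
  have h2 := ((hs.hasSum.sub h1).add h0).tsum_eq
  rw [sub_self, zero_add] at h2
  rw [← h2]
  refine tsum_congr fun n => ?_
  simp only [Function.comp_apply, Equiv.coe_addRight]
  rw [← altTail_sub_altTail_add_one hτ n]
  push_cast
  ring

/-! ### Jacobi's identity for the cube of the Euler product -/

section JacobiIdentity

open Filter Topology

/-- The finite `q`-Pochhammer symbol `(q; q)_n`. -/
noncomputable def qFact (q : ℂ) (n : ℕ) : ℂ := ∏ i ∈ Finset.range n, (1 - q ^ (i + 1))

/-- The Gaussian binomial coefficient. -/
noncomputable def qBinom (q : ℂ) : ℕ → ℕ → ℂ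
  | _, 0 => 1
  | 0, _ + 1 => 0
  | n + 1, k + 1 => q ^ (k + 1) * qBinom q n (k + 1) + qBinom q n k

lemma qBinom_zero_right (q : ℂ) (n : ℕ) : qBinom q n 0 = 1 := by cases n <;> rfl

lemma qBinom_succ_succ (q : ℂ) (n k : ℕ) :
    qBinom q (n + 1) (k + 1) = q ^ (k + 1) * qBinom q n (k + 1) + qBinom q n k := rfl

lemma qBinom_eq_zero (q : ℂ) {n k : ℕ} (h : n < k) : qBinom q n k = 0 := by
  induction n generalizing k with
  | zero =>
    obtain ⟨k, rfl⟩ := Nat.exists_eq_succ_of_ne_zero h.ne'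
    rfl
  | succ n ih =>
    obtain ⟨k, rfl⟩ := Nat.exists_eq_succ_of_ne_zero (by omega : k ≠ 0)
    rw [Nat.succ_eq_add_one, qBinom_succ_succ, ih (by omega), ih (by omega)]
    ring

lemma qFact_succ (q : ℂ) (n : ℕ) : qFact q (n + 1) = qFact q n * (1 - q ^ (n + 1)) :=
  Finset.prod_range_succ _ _

lemma qBinom_mul_qFact (q : ℂ) (j k : ℕ) :
    qBinom q (j + k) k * (qFact q k * qFact q j) = qFact q (j + k) := by
  induction hn : j + k generalizing j k with
  | zero =>
    obtain ⟨rfl, rfl⟩ : j = 0 ∧ k = 0 := by omega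
    simp [qBinom_zero_right, qFact]
  | succ n ih =>
    rcases k with _ | k
    · obtain rfl : j = n + 1 := by omega
      simp [qBinom_zero_right, qFact]
    rw [qBinom_succ_succ]
    have h2 := ih j k (by omega)
    rcases j with _ | j
    · obtain rfl : k = n := by omega
      rw [qBinom_eq_zero q (Nat.lt_succ_self k), qFact_succ]
      linear_combination (1 - q ^ (k + 1)) * h2
    · have h1 := ih j (k + 1) (by omega)
      rw [qFact_succ q j] at *
      rw [qFact_succ q n, show n + 1 = (j + 1) + (k + 1) by omega]
      rw [qFact_succ q k] at *
      linear_combination q ^ (k + 1) * (1 - q ^ (j + 1)) * h1 + (1 - q ^ (k + 1)) * h2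

/-- The finite `q`-binomial theorem. -/
lemma prod_one_sub_mul_pow (q x : ℂ) (n : ℕ) :
    ∏ i ∈ Finset.range n, (1 - x * q ^ i) =
      ∑ k ∈ Finset.range (n + 1), (-1) ^ k * q ^ k.choose 2 * qBinom q n k * x ^ k := by
  induction n generalizing x with
  | zero => simp [qBinom_zero_right]
  | succ n ih =>
    rw [Finset.prod_range_succ']
    have h : ∀ i ∈ Finset.range n, (1 - x * q ^ (i + 1)) = 1 - (x * q) * q ^ i := fun i _ => by
      ring
    rw [Finset.prod_congr rfl h, ih, Finset.sum_range_succ' _ (n + 1)]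
    have h1 : ∀ k ∈ Finset.range (n + 1), (-1) ^ (k + 1) * q ^ (k + 1).choose 2 *
        qBinom q (n + 1) (k + 1) * x ^ (k + 1) =
        (-1) ^ (k + 1) * q ^ (k + 1).choose 2 * qBinom q n (k + 1) * (x * q) ^ (k + 1) -
          x * ((-1) ^ k * q ^ k.choose 2 * qBinom q n k * (x * q) ^ k) := by
      intro k _
      rw [qBinom_succ_succ, Nat.choose_succ_succ' k 1, Nat.choose_one_right]
      ring
    rw [Finset.sum_congr rfl h1, Finset.sum_sub_distrib, ← Finset.mul_sum]
    have h2 := Finset.sum_range_succ'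
      (fun k => (-1) ^ k * q ^ k.choose 2 * qBinom q n k * (x * q) ^ k) (n + 1)
    rw [Finset.sum_range_succ, qBinom_eq_zero q (Nat.lt_succ_self n)] at h2
    simp only [qBinom_zero_right] at *
    linear_combination h2

/-- The logarithmic derivative of the finite `q`-binomial theorem at a zero of the product. -/
lemma sum_mul_qBinom_of_root (q x : ℂ) (a b : ℕ) (hx : x * q ^ a = 1) :
    ∑ k ∈ Finset.range (a + b + 2),
        ((k : ℂ) - (a + 1 : ℕ)) * ((-1) ^ k * q ^ k.choose 2 * qBinom q (a + b + 1) k * x ^ k) =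
      -((∏ i ∈ Finset.range a, (1 - x * q ^ i)) * qFact q b) := by
  -- The value at the root is 0, so the weight k coming from x d/dx may be shifted to k - (a+1) for
  -- free.
  have hzero : ∑ k ∈ Finset.range (a + b + 2),
      (-1) ^ k * q ^ k.choose 2 * qBinom q (a + b + 1) k * x ^ k = 0 := by
    rw [← prod_one_sub_mul_pow]
    exact Finset.prod_eq_zero (i := a) (by simp) (by simp [hx])
  have hfun : (fun y : ℂ => ∏ i ∈ Finset.range (a + b + 1), (1 - y * q ^ i)) =
      fun y : ℂ => (1 - y * q ^ a) * ((∏ i ∈ Finset.range a, (1 - y * q ^ i)) *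
        ∏ i ∈ Finset.range b, (1 - y * q ^ (a + 1 + i))) := by
    funext y
    rw [show a + b + 1 = (a + 1) + b by ring, Finset.prod_range_add, Finset.prod_range_succ]
    ring
  have hdiff : DifferentiableAt ℂ (fun y : ℂ => (∏ i ∈ Finset.range a, (1 - y * q ^ i)) *
        ∏ i ∈ Finset.range b, (1 - y * q ^ (a + 1 + i))) x := by
    refine DifferentiableAt.mul ?_ ?_ <;>
    · refine DifferentiableAt.fun_finsetProd fun i _ => ?_
      fun_prop
  have h1 : HasDerivAt (fun y : ℂ => ∏ i ∈ Finset.range (a + b + 1), (1 - y * q ^ i))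
      (-q ^ a * ((∏ i ∈ Finset.range a, (1 - x * q ^ i)) * qFact q b)) x := by
    rw [hfun]
    have h := (((hasDerivAt_id x).mul_const (q ^ a)).const_sub 1).mul hdiff.hasDerivAt
    have hb : ∏ i ∈ Finset.range b, (1 - x * q ^ (a + 1 + i)) = qFact q b := by
      refine Finset.prod_congr rfl fun i _ => ?_
      linear_combination (-q ^ (i + 1)) * hx
    simp only [id, hx, sub_self, zero_mul, add_zero, one_mul, hb] at h
    exact h
  have h2 : HasDerivAt (fun y : ℂ => ∏ i ∈ Finset.range (a + b + 1), (1 - y * q ^ i))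
      (∑ k ∈ Finset.range (a + b + 2),
        (-1) ^ k * q ^ k.choose 2 * qBinom q (a + b + 1) k * (k * x ^ (k - 1))) x := by
    simp only [prod_one_sub_mul_pow]
    exact HasDerivAt.fun_sum fun k _ => (hasDerivAt_pow k x).const_mul _
  have h3 := h1.unique h2
  have h4 : ∑ k ∈ Finset.range (a + b + 2),
      (k : ℂ) * ((-1) ^ k * q ^ k.choose 2 * qBinom q (a + b + 1) k * x ^ k) =
      x * ∑ k ∈ Finset.range (a + b + 2),
        (-1) ^ k * q ^ k.choose 2 * qBinom q (a + b + 1) k * (k * x ^ (k - 1)) := by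
    rw [Finset.mul_sum]
    refine Finset.sum_congr rfl fun k _ => ?_
    rcases k with _ | k
    · simp
    · rw [Nat.add_sub_cancel]; ring
  simp only [sub_mul, Finset.sum_sub_distrib]
  rw [← Finset.mul_sum, hzero, h4, ← h3]
  linear_combination -((∏ i ∈ Finset.range a, (1 - x * q ^ i)) * qFact q b) * hx

lemma qPow_neg_natCast (τ : ℂ) (n : ℕ) : qPow τ (-n) * qPow τ 1 ^ n = 1 := by
  rw [← qPow_natCast, ← qPow_add]; simp [qPow_zero]

/-- Each factor is 1 - q^(-j) = -q^(-j) (1 - q^j) with 1 ≤ j ≤ n. -/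
lemma prod_one_sub_qPow_neg (τ : ℂ) (n : ℕ) :
    ∏ i ∈ Finset.range n, (1 - qPow τ (-n) * qPow τ 1 ^ i) =
      (-1) ^ n * qPow τ (-(n * (n + 1) / 2)) * qFact (qPow τ 1) n := by
  rw [← Finset.prod_range_reflect]
  induction n with
  | zero => simp [qPow_zero, qFact]
  | succ n ih =>
    have h : ∀ i ∈ Finset.range n, 1 - qPow τ (-(n + 1 : ℕ)) * qPow τ 1 ^ (n + 1 - 1 - i) =
        1 - qPow τ (-n) * qPow τ 1 ^ (n - 1 - i) := by
      intro i hi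
      rw [← qPow_natCast, ← qPow_natCast, ← qPow_add, ← qPow_add]
      congr 2
      have hi := Finset.mem_range.1 hi
      rw [show n + 1 - 1 - i = (n - 1 - i) + 1 by omega]
      push_cast
      ring
    rw [Finset.prod_range_succ, Finset.prod_congr rfl h, ih, qFact_succ]
    have h1 := qPow_neg_natCast τ (n + 1)
    rw [show (-((n + 1 : ℕ) * ((n + 1 : ℕ) + 1) / 2) : ℝ) =
      -(n * (n + 1) / 2) + -(n + 1 : ℕ) by push_cast; ring, qPow_add]
    simp only [Nat.add_sub_cancel, Nat.sub_self, pow_zero, mul_one]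
    linear_combination (-1) ^ n * qPow τ (-(n * (n + 1) / 2)) * qFact (qPow τ 1) n * (-h1)

/-- The finite form of Jacobi's identity for the cube of the Euler product. -/
lemma sum_mul_altTerm_mul_qBinom (τ : ℂ) (n : ℕ) :
    ∑ k ∈ Finset.range (2 * n + 2), ((k - (n + 1 : ℕ) : ℤ) : ℂ) *
        (altTerm τ (k - (n + 1 : ℕ)) * qBinom (qPow τ 1) (2 * n + 1) k) =
      qFact (qPow τ 1) n ^ 2 := by
  have h := sum_mul_qBinom_of_root (qPow τ 1) (qPow τ (-n)) n n (qPow_neg_natCast τ n)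
  rw [prod_one_sub_qPow_neg, ← two_mul] at h
  have h0 : qPow τ (n * (n + 1) / 2) * qPow τ (-(n * (n + 1) / 2)) = 1 := by
    rw [← qPow_add, add_neg_cancel, qPow_zero]
  have hs : ((-1 : ℂ) ^ n) * (-1) ^ n = 1 := by rw [← mul_pow]; simp
  have h1 : qFact (qPow τ 1) n ^ 2 = -(-1) ^ n * qPow τ (n * (n + 1) / 2) *
      (-((-1) ^ n * qPow τ (-(n * (n + 1) / 2)) * qFact (qPow τ 1) n * qFact (qPow τ 1) n)) := by
    linear_combination (-qFact (qPow τ 1) n ^ 2) * h0 - qFact (qPow τ 1) n ^ 2 *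
      qPow τ (n * (n + 1) / 2) * qPow τ (-(n * (n + 1) / 2)) * hs
  rw [h1, ← h, Finset.mul_sum]
  refine Finset.sum_congr rfl fun k _ => ?_
  have hk : altTerm τ (k - (n + 1 : ℕ)) = -(-1) ^ n * qPow τ (n * (n + 1) / 2) *
      ((-1) ^ k * qPow τ 1 ^ k.choose 2 * qPow τ (-n) ^ k) := by
    have hpow : ∀ k : ℕ, qPow τ (-n) ^ k = qPow τ (-n * k) := fun k => by
      induction k with
      | zero => simp [qPow_zero]
      | succ k ih => rw [pow_succ, ih, ← qPow_add]; congr 1; push_cast; ring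
    have hsign : (-1 : ℂ) ^ ((k : ℤ) - (n + 1 : ℕ)) = -(-1) ^ n * (-1) ^ k := by
      rw [negOnePow_congr (b := ((n + 1 + k : ℕ) : ℤ))
        (Int.modEq_iff_dvd.2 ⟨n + 1, by push_cast; ring⟩), zpow_natCast]
      ring
    rw [hpow, altTerm, hsign, ← qPow_natCast, Nat.cast_choose_two,
      show (((k : ℤ) - (n + 1 : ℕ) : ℤ) : ℝ) * (((k : ℤ) - (n + 1 : ℕ) : ℤ) + 1) / 2 =
        n * (n + 1) / 2 + (k * (k - 1) / 2 + -n * k) by push_cast; ring, qPow_add, qPow_add]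
    ring
  rw [hk]
  push_cast
  ring

lemma one_sub_pow_succ_ne_zero {q : ℂ} (hq : ‖q‖ < 1) (i : ℕ) : 1 - q ^ (i + 1) ≠ 0 := by
  intro h
  have h1 : ‖q ^ (i + 1)‖ < 1 := by
    rw [norm_pow]
    exact pow_lt_one₀ (norm_nonneg _) hq (by omega)
  rw [← sub_eq_zero.1 h, norm_one] at h1
  exact lt_irrefl _ h1

lemma qFact_ne_zero {q : ℂ} (hq : ‖q‖ < 1) (n : ℕ) : qFact q n ≠ 0 :=
  Finset.prod_ne_zero_iff.2 fun i _ => one_sub_pow_succ_ne_zero hq i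

lemma tendsto_qFact {q : ℂ} (hq : ‖q‖ < 1) : Tendsto (qFact q) atTop (𝓝 (qPochInf q q)) := by
  have h1 : qPochInf q q = ∏' i : ℕ, (1 - q ^ (i + 1)) := by
    simp only [qPochInf, pow_succ']
  rw [h1]
  exact (ModularForm.multipliable_one_sub_pow hq).hasProd.tendsto_prod_nat

lemma qPochInf_self_ne_zero {q : ℂ} (hq : ‖q‖ < 1) : qPochInf q q ≠ 0 := by
  have h := tprod_one_add_ne_zero_of_summable (f := fun i : ℕ => -q ^ (i + 1))
    (fun i => by simpa [sub_eq_add_neg] using one_sub_pow_succ_ne_zero hq i)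
    (by
      simpa using (summable_nat_add_iff 1).mpr
        (summable_geometric_of_lt_one (norm_nonneg _) hq))
  simpa only [qPochInf, ← sub_eq_add_neg, pow_succ'] using h

lemma qBinom_eq_div {q : ℂ} (hq : ‖q‖ < 1) (j k : ℕ) :
    qBinom q (j + k) k = qFact q (j + k) * ((qFact q k)⁻¹ * (qFact q j)⁻¹) := by
  rw [← qBinom_mul_qFact]
  have := qFact_ne_zero hq k
  have := qFact_ne_zero hq j
  field_simp

/-- Both (q)_n and its inverse converge, hence are bounded. This gives the domination needed to pass
to the limit in the finite identity. -/
lemma exists_norm_qBinom_le {q : ℂ} (hq : ‖q‖ < 1) : ∃ C : ℝ, ∀ n k, ‖qBinom q n k‖ ≤ C := by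
  obtain ⟨A, hA⟩ := (Metric.isBounded_range_of_tendsto _ (tendsto_qFact hq)).exists_norm_le
  obtain ⟨B, hB⟩ := (Metric.isBounded_range_of_tendsto _
    ((tendsto_qFact hq).inv₀ (qPochInf_self_ne_zero hq))).exists_norm_le
  simp only [Set.mem_range, forall_exists_index, forall_apply_eq_imp_iff] at hA hB
  have hA0 : 0 ≤ A := (norm_nonneg _).trans (hA 0)
  have hB0 : 0 ≤ B := (norm_nonneg _).trans (hB 0)
  refine ⟨A * (B * B), fun n k => ?_⟩
  rcases lt_or_ge n k with h | h
  · rw [qBinom_eq_zero q h, norm_zero]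
    positivity
  · obtain ⟨j, rfl⟩ := Nat.exists_eq_add_of_le' h
    rw [qBinom_eq_div hq, norm_mul, norm_mul]
    gcongr
    exacts [hA _, hB _, hB _]

lemma tendsto_qBinom_central {q : ℂ} (hq : ‖q‖ < 1) (j : ℤ) :
    Tendsto (fun n : ℕ => qBinom q (2 * n + 1) (j + (n + 1 : ℕ)).toNat) atTop
      (𝓝 (qPochInf q q)⁻¹) := by
  have ht := tendsto_qFact hq
  have hi := ht.inv₀ (qPochInf_self_ne_zero hq)
  have h1 : Tendsto (fun n : ℕ => 2 * n + 1) atTop atTop :=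
    tendsto_atTop_mono (fun n => by dsimp only [id]; omega) tendsto_id
  have h2 : Tendsto (fun n : ℕ => (j + (n + 1 : ℕ)).toNat) atTop atTop :=
    tendsto_atTop_mono' (f₁ := fun n : ℕ => n - j.natAbs) _
      (Eventually.of_forall fun n => by dsimp only; omega) (tendsto_sub_atTop_nat _)
  have h3 : Tendsto (fun n : ℕ => (n - j).toNat) atTop atTop :=
    tendsto_atTop_mono' (f₁ := fun n : ℕ => n - j.natAbs) _
      (Eventually.of_forall fun n => by dsimp only; omega) (tendsto_sub_atTop_nat _)
  have h := (ht.comp h1).mul ((hi.comp h2).mul (hi.comp h3))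
  rw [mul_inv_cancel_left₀ (qPochInf_self_ne_zero hq)] at h
  refine h.congr' ?_
  filter_upwards [eventually_ge_atTop (j.natAbs)] with n hn
  have h4 : 2 * n + 1 = (n - j).toNat + (j + (n + 1 : ℕ)).toNat := by omega
  simp only [Function.comp_apply]
  rw [h4, qBinom_eq_div hq]

/-- Jacobi's identity `∑ n (-1) ^ n q ^ (n (n + 1) / 2) = (q; q)_∞ ^ 3`, summed over `n ∈ ℤ`. -/
theorem tsum_mul_altTerm {τ : ℂ} (hτ : 0 < τ.im) :
    ∑' n : ℤ, (n : ℂ) * altTerm τ n = qPochInf (qPow τ 1) (qPow τ 1) ^ 3 := by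
  have hq := norm_qPow_one_lt_one hτ
  set q := qPow τ 1 with hqdef
  set L := qPochInf q q with hL
  have hL0 : L ≠ 0 := qPochInf_self_ne_zero hq
  -- The guard is needed because `toNat` sends negative lower indices to 0, where `qBinom` is 1. As
  -- n grows, the finite identity tends to ∑ j (-1)^j q^(j(j+1)/2) / L = L^2.
  let f : ℕ → ℤ → ℂ := fun n j => (j : ℂ) * (altTerm τ j *
    if 0 ≤ j + (n + 1 : ℕ) then qBinom q (2 * n + 1) (j + (n + 1 : ℕ)).toNat else 0)
  have hsum : ∀ n, ∑' j, f n j = qFact q n ^ 2 := by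
    intro n
    rw [← sum_mul_altTerm_mul_qBinom, ← (Equiv.subRight ((n + 1 : ℕ) : ℤ)).tsum_eq,
      tsum_eq_sum (s := (Finset.range (2 * n + 2)).map Nat.castEmbedding), Finset.sum_map]
    · refine Finset.sum_congr rfl fun k _ => ?_
      simp [f, hqdef]
    · intro k hk
      simp only [f, Equiv.subRight_apply, sub_add_cancel]
      split_ifs with h0
      · rw [qBinom_eq_zero, mul_zero, mul_zero]
        by_contra hlt
        refine hk (Finset.mem_map.2 ⟨k.toNat, Finset.mem_range.2 (by omega), ?_⟩)
        simpa using h0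
      · simp
  obtain ⟨C, hC⟩ := exists_norm_qBinom_le hq
  have hC0 : 0 ≤ C := (norm_nonneg _).trans (hC 0 0)
  have hlim := tendsto_tsum_of_dominated_convergence (𝓕 := atTop) (f := f)
    (g := fun j : ℤ => (j : ℂ) * (altTerm τ j * L⁻¹))
    (bound := fun j : ℤ => |(j : ℝ)| ^ 1 * ‖altTerm τ j‖ * C)
    ((summable_pow_mul_norm_altTerm hτ 1).mul_right C) ?_ ?_
  · simp only [hsum] at hlim
    have h1 := tendsto_nhds_unique hlim ((tendsto_qFact hq).pow 2)
    simp only [← mul_assoc] at h1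
    rw [tsum_mul_right, ← div_eq_mul_inv, div_eq_iff hL0] at h1
    rw [h1]
    ring
  · intro j
    refine Tendsto.const_mul _ (Tendsto.const_mul _ ?_)
    refine (tendsto_qBinom_central hq j).congr' ?_
    filter_upwards [eventually_ge_atTop j.natAbs] with n hn
    rw [if_pos (by omega)]
  · refine Eventually.of_forall fun n j => ?_
    simp only [f, norm_mul, pow_one, mul_assoc, Complex.norm_intCast]
    gcongr
    split_ifs
    · exact hC _ _
    · simpa using hC0

end JacobiIdentity

/-! ### Evaluation of the double sums over tails -/

lemma tsum_mul_qPow_mul_altTail {τ : ℂ} (hτ : 0 < τ.im) (c : ℤ → ℂ) (h : ℤ → ℤ)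
    (hs : Summable fun x : ℤ × ℤ => c x.1 * (qPow τ (-(h x.1 * x.2)) * altTail τ x.2)) :
    ∑' x : ℤ × ℤ, c x.1 * (qPow τ (-(h x.1 * x.2)) * altTail τ x.2) =
      ∑' w : ℤ, if h w = 0 then c w * qPochInf (qPow τ 1) (qPow τ 1) ^ 3 else 0 := by
  rw [hs.tsum_prod]
  refine tsum_congr fun w => ?_
  dsimp only
  rw [tsum_mul_left]
  split_ifs with hw
  · rw [← tsum_mul_altTerm hτ, ← tsum_altTail hτ]
    simp [hw, qPow_zero]
  · rw [tsum_qPow_mul_altTail_of_ne_zero hτ hw, mul_zero]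

lemma tsum_ite_affine_eq_zero {g a : ℤ} (hg : g ≠ 0) (c : ℤ → ℂ) (b : ℂ)
    (hc : ∀ w, a + g * w = 0 → c w = b) :
    (∑' w : ℤ, if a + g * w = 0 then c w else 0) = if g ∣ a then b else 0 := by
  split_ifs with h
  · obtain ⟨w, rfl⟩ := h
    rw [tsum_eq_single (-w), if_pos (by ring), hc _ (by ring)]
    intro w' hw'
    refine if_neg fun h0 => hw' ?_
    have h1 : g * (w + w') = 0 := by linarith
    have := (mul_eq_zero.1 h1).resolve_left hg
    linarith
  · rw [tsum_congr (g := fun _ => (0 : ℂ)), tsum_zero]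
    intro w
    exact if_neg fun h0 => h ⟨-w, by linarith⟩

/-- The weight with which a pair of theta tails occurs after summing along the diagonals. -/
noncomputable def tailWeight (τ : ℂ) (t : ℕ) (m e v : ℤ) : ℂ :=
  (-1 : ℂ) ^ (v + e) * qPow τ (1 / 8 +
    ((e : ℝ) - m - (2 * t - 1) * v) * (e + m + (2 * t - 1) * v - (2 * t - 1)) / (2 * (2 * t - 1)))

lemma two_mul_sub_one_pos {t : ℕ} (ht : 1 ≤ t) : (0 : ℝ) < 2 * t - 1 := by
  have : (1 : ℝ) ≤ t := by exact_mod_cast ht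
  linarith

/-- The change of variables `w = d + v`, `n = l + g w + v`. -/
def addShearEquiv (g l : ℤ) : ℤ × ℤ ≃ ℤ × ℤ where
  toFun x := (x.1 - (x.2 - l - g * x.1), x.2 - l - g * x.1)
  invFun y := (y.1 + y.2, l + g * (y.1 + y.2) + y.2)
  left_inv x := by ext <;> dsimp only <;> ring
  right_inv y := by ext <;> dsimp only <;> ring

/-- The change of variables `w = d - v`, `n = v - l - g w`. -/
def subShearEquiv (g l : ℤ) : ℤ × ℤ ≃ ℤ × ℤ where
  toFun x := (x.1 + (x.2 + l + g * x.1), x.2 + l + g * x.1)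
  invFun y := (y.1 - y.2, y.2 - l - g * (y.1 - y.2))
  left_inv x := by ext <;> dsimp only <;> ring
  right_inv y := by ext <;> dsimp only <;> ring

lemma tsum_tailWeight_mul_altTail_add {τ : ℂ} (hτ : 0 < τ.im) {t : ℕ} (ht : 1 ≤ t) (m l : ℤ)
    (hs : Summable fun x : ℤ × ℤ => tailWeight τ t m (l + (2 * t - 1) * x.1) x.2 *
      altTail τ (2 * t * x.2 + (l + (2 * t - 1) * x.1))) :
    ∑' x : ℤ × ℤ, tailWeight τ t m (l + (2 * t - 1) * x.1) x.2 *
      altTail τ (2 * t * x.2 + (l + (2 * t - 1) * x.1)) =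
    if 2 * (t : ℤ) - 1 ∣ l + m then
      (-1 : ℂ) ^ (m + 1) * qPow τ (1 / 8) * qPochInf (qPow τ 1) (qPow τ 1) ^ 3 else 0 := by
  have hg := two_mul_sub_one_pos ht
  set c : ℤ → ℂ := fun w => (-1 : ℂ) ^ (l + w) * qPow τ (1 / 8 +
    ((l : ℝ) - m + (2 * t - 1) * w + 2 * (2 * t - 1) * (l + (2 * t - 1) * w)) *
      (l + m + (2 * t - 1) * (w - 1)) / (2 * (2 * t - 1))) with hc
  set h : ℤ → ℤ := fun w => l + m - (2 * t - 1) + (2 * t - 1) * w with hh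
  -- In the new coordinates the second factor of the exponent of `tailWeight` is h(w), while the
  -- first is affine in n with slope -2(2t-1); hence the twist q^(-h(w)n).
  have key : ∀ x : ℤ × ℤ, tailWeight τ t m (l + (2 * t - 1) * (addShearEquiv (2 * t - 1) l x).1)
        (addShearEquiv (2 * t - 1) l x).2 * altTail τ (2 * t * (addShearEquiv (2 * t - 1) l x).2 +
          (l + (2 * t - 1) * (addShearEquiv (2 * t - 1) l x).1)) =
      c x.1 * (qPow τ (-(h x.1 * x.2)) * altTail τ x.2) := by
    rintro ⟨w, n⟩
    simp only [addShearEquiv, Equiv.coe_fn_mk, hc, hh, tailWeight]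
    rw [mul_assoc, mul_assoc ((-1 : ℂ) ^ (l + w)), ← mul_assoc (qPow _ _) (qPow _ _), ← qPow_add]
    congr 1
    · exact negOnePow_congr (Int.modEq_iff_dvd.2
        ⟨-(t - 1) * (w - (n - l - (2 * t - 1) * w)), by ring⟩)
    · congr 2
      · push_cast
        field_simp
        ring
      · ring
  have hs' := (addShearEquiv (2 * t - 1) l).summable_iff.2 hs
  simp only [Function.comp_def, key] at hs'
  rw [← (addShearEquiv (2 * t - 1) l).tsum_eq]
  simp only [key]
  rw [tsum_mul_qPow_mul_altTail hτ c h hs']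
  rw [tsum_ite_affine_eq_zero (by omega) _
    ((-1 : ℂ) ^ (m + 1) * qPow τ (1 / 8) * qPochInf (qPow τ 1) (qPow τ 1) ^ 3)]
  · simp only [dvd_sub_self_right]
  · intro w hw
    have hwr : (l : ℝ) + m + (2 * t - 1) * (w - 1) = 0 := by
      have : ((l + m - (2 * t - 1) + (2 * t - 1) * w : ℤ) : ℝ) = 0 := by rw [hw]; simp
      push_cast at this
      linarith
    simp only [hc, hwr, mul_zero, zero_div, add_zero]
    rw [negOnePow_congr (b := m + 1) (Int.modEq_iff_dvd.2 ⟨m + (t - 1) * (w - 1), by linarith⟩)]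

lemma tsum_tailWeight_mul_altTail_sub {τ : ℂ} (hτ : 0 < τ.im) {t : ℕ} (ht : 1 ≤ t) (m l : ℤ)
    (hs : Summable fun x : ℤ × ℤ => tailWeight τ t m (l + (2 * t - 1) * x.1) x.2 *
      altTail τ (2 * t * x.2 - (l + (2 * t - 1) * x.1))) :
    ∑' x : ℤ × ℤ, tailWeight τ t m (l + (2 * t - 1) * x.1) x.2 *
      altTail τ (2 * t * x.2 - (l + (2 * t - 1) * x.1)) =
    if 2 * (t : ℤ) - 1 ∣ m - l then
      (-1 : ℂ) ^ m * qPow τ (1 / 8) * qPochInf (qPow τ 1) (qPow τ 1) ^ 3 else 0 := by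
  have hg := two_mul_sub_one_pos ht
  set c : ℤ → ℂ := fun w => (-1 : ℂ) ^ (l + w) * qPow τ (1 / 8 +
    ((l : ℝ) - m + (2 * t - 1) * w) * (l + m + (2 * t - 1) * (w - 1) +
      2 * (2 * t - 1) * (l + (2 * t - 1) * w)) / (2 * (2 * t - 1))) with hc
  set h : ℤ → ℤ := fun w => m - l + (2 * t - 1) * -w with hh
  -- Now the first factor is constant along n, equal to -h(w), and the second has slope 2(2t-1).
  have key : ∀ x : ℤ × ℤ, tailWeight τ t m (l + (2 * t - 1) * (subShearEquiv (2 * t - 1) l x).1)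
        (subShearEquiv (2 * t - 1) l x).2 * altTail τ (2 * t * (subShearEquiv (2 * t - 1) l x).2 -
          (l + (2 * t - 1) * (subShearEquiv (2 * t - 1) l x).1)) =
      c x.1 * (qPow τ (-(h x.1 * x.2)) * altTail τ x.2) := by
    rintro ⟨w, n⟩
    simp only [subShearEquiv, Equiv.coe_fn_mk, hc, hh, tailWeight]
    rw [mul_assoc, mul_assoc ((-1 : ℂ) ^ (l + w)), ← mul_assoc (qPow _ _) (qPow _ _), ← qPow_add]
    congr 1
    · exact negOnePow_congr (Int.modEq_iff_dvd.2
        ⟨-(t - 1) * w - t * (n + l + (2 * t - 1) * w), by ring⟩)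
    · congr 2
      · push_cast
        field_simp
        ring
      · ring
  have hs' := (subShearEquiv (2 * t - 1) l).summable_iff.2 hs
  simp only [Function.comp_def, key] at hs'
  rw [← (subShearEquiv (2 * t - 1) l).tsum_eq]
  simp only [key]
  rw [tsum_mul_qPow_mul_altTail hτ c h hs', ← (Equiv.neg ℤ).tsum_eq]
  simp only [hh, Equiv.neg_apply, neg_neg]
  rw [tsum_ite_affine_eq_zero (by omega) _
    ((-1 : ℂ) ^ m * qPow τ (1 / 8) * qPochInf (qPow τ 1) (qPow τ 1) ^ 3)]
  intro w hw
  have hwr : (l : ℝ) - m + (2 * t - 1) * (-w : ℤ) = 0 := by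
    have : ((m - l + (2 * t - 1) * w : ℤ) : ℝ) = 0 := by rw [hw]; simp
    push_cast at this ⊢
    linarith
  simp only [hc, hwr, zero_mul, zero_div, add_zero]
  rw [negOnePow_congr (b := m) (Int.modEq_iff_dvd.2 ⟨-(t - 1) * w, by linarith⟩)]

/-! ### The triple series -/

/-- The sign of the indefinite theta series, read off on the diagonals. -/
def coneSign (t : ℕ) (v n : ℤ) : ℂ :=
  if 2 * t * |v| ≤ n then 1 else if n < -(2 * t * |v|) then -1 else 0

lemma tsum_ite_le_altTerm (τ : ℂ) (b e : ℤ) :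
    (∑' n : ℤ, if b ≤ n then altTerm τ (n + e) else 0) = altTail τ (b + e) := by
  rw [altTail, ← Function.Injective.tsum_eq (g := fun j : ℕ => b + (j : ℤ))]
  · refine tsum_congr fun j => ?_
    rw [if_pos (by omega)]
    congr 1
    ring
  · intro x y h
    simpa using h
  · intro n hn
    have h : b ≤ n := by
      by_contra h
      simp [h] at hn
    exact ⟨(n - b).toNat, by dsimp only; omega⟩

lemma tsum_ite_lt_altTerm (τ : ℂ) (b e : ℤ) :
    (∑' n : ℤ, if n < -b then -altTerm τ (n + e) else 0) = altTail τ (b - e) := by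
  have h1 := tsum_altTerm_below τ (e - b)
  rw [neg_sub] at h1
  rw [← neg_eq_iff_eq_neg.2 h1, ← tsum_neg,
    ← Function.Injective.tsum_eq (g := fun j : ℕ => -b - 1 - (j : ℤ))]
  · refine tsum_congr fun j => ?_
    rw [if_pos (by omega)]
    congr 2
    ring
  · intro x y h
    simpa using h
  · intro n hn
    have h : n < -b := by
      by_contra h
      simp [h] at hn
    exact ⟨(-b - 1 - n).toNat, by dsimp only; omega⟩

/-- The term of the triple series, with the diagonal index `x.2` summed innermost. -/
noncomputable def tripleTerm (τ : ℂ) (t : ℕ) (m l : ℤ) (x : (ℤ × ℤ) × ℤ) : ℂ :=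
  tailWeight τ t m (l + (2 * t - 1) * x.1.1) x.1.2 *
    (coneSign t x.1.2 x.2 * altTerm τ (x.2 + (l + (2 * t - 1) * x.1.1)))

lemma tsum_tripleTerm {τ : ℂ} (hτ : 0 < τ.im) {t : ℕ} (ht : 1 ≤ t) (m l : ℤ)
    (hs : Summable (tripleTerm τ t m l)) :
    ∑' x, tripleTerm τ t m l x =
      (if 2 * (t : ℤ) - 1 ∣ l + m then
        (-1 : ℂ) ^ (m + 1) * qPow τ (1 / 8) * qPochInf (qPow τ 1) (qPow τ 1) ^ 3 else 0) +
      if 2 * (t : ℤ) - 1 ∣ m - l then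
        (-1 : ℂ) ^ m * qPow τ (1 / 8) * qPochInf (qPow τ 1) (qPow τ 1) ^ 3 else 0 := by
  let W : ℤ × ℤ → ℂ := fun x => tailWeight τ t m (l + (2 * t - 1) * x.1) x.2
  let s₁ : Set ((ℤ × ℤ) × ℤ) := {x | 2 * t * |x.1.2| ≤ x.2}
  let s₂ : Set ((ℤ × ℤ) × ℤ) := {x | x.2 < -(2 * t * |x.1.2|)}
  have hf₁ := hs.indicator s₁
  have hf₂ := hs.indicator s₂
  have hdecomp : ∀ x, tripleTerm τ t m l x =
      s₁.indicator (tripleTerm τ t m l) x + s₂.indicator (tripleTerm τ t m l) x := by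
    rintro ⟨⟨d, v⟩, n⟩
    have hv : 0 ≤ 2 * (t : ℤ) * |v| := by positivity
    by_cases h1 : 2 * t * |v| ≤ n
    · have h2 : ¬n < -(2 * t * |v|) := by omega
      simp [s₁, s₂, Set.indicator, h1, h2]
    · by_cases h2 : n < -(2 * t * |v|)
      · simp [s₁, s₂, Set.indicator, h1, h2]
      · simp [s₁, s₂, Set.indicator, h1, h2, tripleTerm, coneSign]
  have hin₁ : ∀ x : ℤ × ℤ, ∑' n, s₁.indicator (tripleTerm τ t m l) (x, n) =
      W x * altTail τ (2 * t * |x.2| + (l + (2 * t - 1) * x.1)) := by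
    rintro ⟨d, v⟩
    rw [← tsum_ite_le_altTerm, ← tsum_mul_left]
    refine tsum_congr fun n => ?_
    by_cases h1 : 2 * t * |v| ≤ n
    · simp [s₁, Set.indicator, h1, tripleTerm, coneSign, W]
    · simp [s₁, Set.indicator, h1]
  have hin₂ : ∀ x : ℤ × ℤ, ∑' n, s₂.indicator (tripleTerm τ t m l) (x, n) =
      W x * altTail τ (2 * t * |x.2| - (l + (2 * t - 1) * x.1)) := by
    rintro ⟨d, v⟩
    rw [← tsum_ite_lt_altTerm, ← tsum_mul_left]
    refine tsum_congr fun n => ?_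
    have hv : 0 ≤ 2 * (t : ℤ) * |v| := by positivity
    by_cases h2 : n < -(2 * t * |v|)
    · have h1 : ¬2 * t * |v| ≤ n := by omega
      simp [s₂, Set.indicator, h1, h2, tripleTerm, coneSign, W]
    · simp [s₂, Set.indicator, h2]
  have hF₁ := hf₁.prod
  have hF₂ := hf₂.prod
  simp only [hin₁] at hF₁
  simp only [hin₂] at hF₂
  let p : Set (ℤ × ℤ) := {x | 0 ≤ x.2}
  -- For v < 0 evenness turns T(2tv + e) into T(2t|v| - e). So this family is the first one on v ≥ 0
  -- glued to the second on v < 0.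
  have hG₁ : Summable fun x : ℤ × ℤ => W x *
      altTail τ (2 * t * x.2 + (l + (2 * t - 1) * x.1)) := by
    refine ((hF₁.indicator p).add (hF₂.indicator pᶜ)).congr ?_
    rintro ⟨d, v⟩
    by_cases hv : 0 ≤ v
    · simp [p, Set.indicator, hv, abs_of_nonneg]
    · rw [← altTail_neg hτ]
      simp only [p, Set.indicator, Set.mem_compl_iff, Set.mem_ofPred_eq, hv, if_false, not_false_iff,
        if_true, zero_add, abs_of_neg (not_le.1 hv)]
      congr 2
      ring
  have hG₂ : Summable fun x : ℤ × ℤ => W x *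
      altTail τ (2 * t * x.2 - (l + (2 * t - 1) * x.1)) := by
    refine ((hF₂.indicator p).add (hF₁.indicator pᶜ)).congr ?_
    rintro ⟨d, v⟩
    by_cases hv : 0 ≤ v
    · simp [p, Set.indicator, hv, abs_of_nonneg]
    · rw [← altTail_neg hτ]
      simp only [p, Set.indicator, Set.mem_compl_iff, Set.mem_ofPred_eq, hv, if_false, not_false_iff,
        if_true, zero_add, abs_of_neg (not_le.1 hv)]
      congr 2
      ring
  rw [← tsum_tailWeight_mul_altTail_add hτ ht m l hG₁,
    ← tsum_tailWeight_mul_altTail_sub hτ ht m l hG₂, ← hG₁.tsum_add hG₂, tsum_congr hdecomp,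
    hf₁.tsum_add hf₂, hf₁.tsum_prod, hf₂.tsum_prod]
  simp only [hin₁, hin₂]
  rw [← hF₁.tsum_add hF₂]
  refine tsum_congr ?_
  rintro ⟨d, v⟩
  -- Replacing |v| by v is legitimate only in the sum of the two tails: if |v| = -v, they trade
  -- places.
  rcases abs_choice v with hv | hv
  · simp only [hv, W]
  · simp only [hv, W]
    rw [← altTail_neg hτ (2 * t * v + _), ← altTail_neg hτ (2 * t * v - _), add_comm]
    congr 3 <;> ring

/-! ### Absolute convergence and parametrization of the index sets -/

/-- Where the sign factor is nonzero, rs ≥ 0, so the indefinite cross term only helps and a product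
of two Gaussians dominates. -/
lemma norm_thetaTerm_le {τ : ℂ} (hτ : 0 < τ.im) {t : ℕ} (ht : 1 ≤ t) (p m r s : ℤ) :
    ‖thetaTerm τ t p m r s‖ ≤
      ‖qPow τ (1 / 8 * (r : ℝ) ^ 2 + (4 * p - 1 - 2 * m) / 4 * r + 0)‖ *
        ‖qPow τ (1 / 8 * (s : ℝ) ^ 2 + (1 + 2 * m) / 4 * s + 0)‖ := by
  have ht' : (1 : ℝ) ≤ t := by exact_mod_cast ht
  by_cases h : sgPair r s = 0
  · rw [thetaTerm, h, zero_mul, zero_mul, norm_zero]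
    positivity
  have hsg : ‖sgPair r s‖ = 1 ∧ 0 ≤ r * s := by
    unfold sgPair sg at *
    split_ifs at h ⊢ with h1 h2 h2
    · exact ⟨by norm_num, mul_nonneg h1 h2⟩
    · norm_num at h
    · norm_num at h
    · exact ⟨by norm_num, (mul_pos_of_neg_of_neg (not_le.1 h1) (not_le.1 h2)).le⟩
  have hrs : (0 : ℝ) ≤ r * s := by exact_mod_cast hsg.2
  rw [thetaTerm, norm_mul, norm_mul, hsg.1, norm_negOnePow, one_mul, one_mul, ← norm_mul,
    ← qPow_add]
  refine norm_qPow_le hτ ?_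
  rw [Bexp]
  nlinarith [mul_nonneg (sub_nonneg.2 ht') hrs]

lemma summable_norm_thetaTerm {τ : ℂ} (hτ : 0 < τ.im) {t : ℕ} (ht : 1 ≤ t) (p m : ℤ) :
    Summable fun x : ℤ × ℤ => ‖thetaTerm τ t p m x.1 x.2‖ :=
  ((summable_norm_qPow_quadratic hτ (by norm_num) _ _).mul_of_nonneg
    (summable_norm_qPow_quadratic hτ (by norm_num) _ _) (fun _ => norm_nonneg _)
    fun _ => norm_nonneg _).of_nonneg_of_le (fun _ => norm_nonneg _)
    fun x => norm_thetaTerm_le hτ ht p m x.1 x.2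

lemma summable_norm_unaryTerm {τ : ℂ} (hτ : 0 < τ.im) {t : ℕ} (ht : 1 ≤ t) :
    Summable fun r : ℤ => ‖unaryTerm τ t r‖ := by
  have hg := two_mul_sub_one_pos ht
  have ht' : (0 : ℝ) < t := by exact_mod_cast ht
  convert summable_norm_qPow_quadratic hτ (a := 1 / (4 * t * (2 * t - 1))) (by positivity) 0 0
    using 3 with r
  rw [unaryTerm]
  congr 1
  ring

/-- Pairs of integers of equal parity, parametrized by half their sum and half their difference. -/
def parityPairEquiv : ℤ × ℤ ≃ {x : ℤ × ℤ // x.1 ≡ x.2 [ZMOD 2]} where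
  toFun x := ⟨(x.1 + x.2, x.1 - x.2), Int.modEq_iff_dvd.2 ⟨-x.2, by dsimp only; ring⟩⟩
  invFun y := ((y.1.1 + y.1.2) / 2, (y.1.1 - y.1.2) / 2)
  left_inv x := by ext <;> dsimp only <;> omega
  right_inv y := by
    obtain ⟨⟨r, s⟩, h⟩ := y
    have h' : r % 2 = s % 2 := h
    ext <;> dsimp only <;> omega

/-- A residue class modulo `M`, parametrized by the integers. -/
def residueClassEquiv (a : ℤ) {M : ℤ} (hM : M ≠ 0) : ℤ ≃ {r : ℤ // r ≡ a [ZMOD M]} where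
  toFun n := ⟨a + M * n, Int.modEq_iff_dvd.2 ⟨-n, by ring⟩⟩
  invFun r := (r.1 - a) / M
  left_inv n := by simp [hM]
  right_inv r := by
    obtain ⟨r, hr⟩ := r
    ext
    dsimp only
    rw [Int.mul_ediv_cancel' (Int.modEq_iff_dvd.1 hr.symm)]
    ring

lemma theta_eq_tsum (τ : ℂ) (t : ℕ) (p m : ℤ) :
    theta τ t p m = ∑' x : ℤ × ℤ, thetaTerm τ t p m (x.1 + x.2) (x.1 - x.2) :=
  (parityPairEquiv.tsum_eq _).symm

lemma unaryTheta_eq_tsum (τ : ℂ) {t : ℕ} (ht : 1 ≤ t) (a : ℤ) :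
    unaryTheta τ t a = ∑' n : ℤ, unaryTerm τ t (a + 2 * t * (2 * t - 1) * n) :=
  ((residueClassEquiv a (M := 2 * t * (2 * t - 1))
    (mul_ne_zero (by omega) (by omega))).tsum_eq _).symm

/-! ### Reduction of the theorem to the triple series -/

/-- As 0 ≤ k < 2t, comparing k + 2tu with multiples of 2t only tests u. The convention that 0 has
sign 1 makes the positive cone closed and the negative one open. -/
lemma sgPair_add_sub {t : ℕ} {k : ℕ} (hk : k < 2 * t) (u v : ℤ) :
    sgPair (u + v) (u - v) = coneSign t v (k + 2 * t * u) := by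
  have ht : (0 : ℤ) < 2 * t := by omega
  have h1 : 2 * t * |v| ≤ k + 2 * t * u ↔ |v| ≤ u := by
    constructor
    · intro h
      by_contra! h'
      nlinarith
    · intro h
      nlinarith
  have h2 : (k : ℤ) + 2 * t * u < -(2 * t * |v|) ↔ u < -|v| := by
    constructor
    · intro h
      by_contra! h'
      nlinarith
    · intro h
      have : u + 1 ≤ -|v| := h
      nlinarith
  have h3 : |v| ≤ u ↔ 0 ≤ u + v ∧ 0 ≤ u - v := by rw [abs_le]; omega
  have h4 : u < -|v| ↔ u + v < 0 ∧ u - v < 0 := by rw [lt_neg, abs_lt]; omega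
  simp only [coneSign, h1, h2, h3, h4, sgPair, sg]
  split_ifs <;> first | omega | norm_num

/-- The algebraic core: k and u enter the combined exponent only through N = k + 2tu and d = n - u,
and N only through the triangular number of N + e. -/
lemma thetaTerm_mul_unaryTerm {τ : ℂ} {t : ℕ} (ht : 1 ≤ t) (m l : ℤ) {k : ℕ} (hk : k < 2 * t)
    (u v n : ℤ) :
    (-1 : ℂ) ^ k * qPow τ (Cexp t (t + k) (m + k)) *
      (thetaTerm τ t (t + k) (m + k) (u + v) (u - v) *
        unaryTerm τ t (2 * t * l + (2 * t - 1) * k + 2 * t * (2 * t - 1) * n)) =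
    tripleTerm τ t m l ((n - u, v), k + 2 * t * u) := by
  have hg := (two_mul_sub_one_pos ht).ne'
  have ht' : (t : ℝ) ≠ 0 := by exact_mod_cast (by omega : t ≠ 0)
  have hexp : Cexp t (t + k) (m + k) + Bexp t (t + k) (m + k) (u + v) (u - v) +
      ((2 * t * l + (2 * t - 1) * k + 2 * t * (2 * t - 1) * n : ℤ) : ℝ) ^ 2 /
        (4 * t * (2 * t - 1)) =
      (1 / 8 + (((l + (2 * t - 1) * (n - u) : ℤ) : ℝ) - m - (2 * t - 1) * v) *
        ((l + (2 * t - 1) * (n - u) : ℤ) + m + (2 * t - 1) * v - (2 * t - 1)) /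
          (2 * (2 * t - 1))) +
      ((k + 2 * t * u + (l + (2 * t - 1) * (n - u)) : ℤ) : ℝ) *
        ((k + 2 * t * u + (l + (2 * t - 1) * (n - u)) : ℤ) + 1) / 2 := by
    rw [Cexp, Bexp]
    push_cast
    field_simp
    ring
  have hsign : (-1 : ℂ) ^ k * (-1 : ℂ) ^ v = (-1 : ℂ) ^ (v + (l + (2 * t - 1) * (n - u))) *
      (-1 : ℂ) ^ (k + 2 * t * u + (l + (2 * t - 1) * (n - u))) := by
    rw [← zpow_natCast, ← zpow_add₀ (by simp), ← zpow_add₀ (by simp)]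
    exact negOnePow_congr (Int.modEq_iff_dvd.2 ⟨l + (2 * t - 1) * (n - u) + t * u, by ring⟩)
  rw [thetaTerm, unaryTerm, tripleTerm, tailWeight, altTerm, ← sgPair_add_sub hk,
    show (u + v - (u - v)) / 2 = v by omega]
  dsimp only
  have hq := congrArg (qPow τ) hexp
  rw [qPow_add, qPow_add, qPow_add _ (1 / 8 + _)] at hq
  linear_combination sgPair (u + v) (u - v) * (-1 : ℂ) ^ k * (-1 : ℂ) ^ v * hq +
    sgPair (u + v) (u - v) *
      qPow τ (1 / 8 + (((l + (2 * t - 1) * (n - u) : ℤ) : ℝ) - m - (2 * t - 1) * v) *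
        ((l + (2 * t - 1) * (n - u) : ℤ) + m + (2 * t - 1) * v - (2 * t - 1)) /
          (2 * (2 * t - 1))) *
      qPow τ (((k + 2 * t * u + (l + (2 * t - 1) * (n - u)) : ℤ) : ℝ) *
        ((k + 2 * t * u + (l + (2 * t - 1) * (n - u)) : ℤ) + 1) / 2) * hsign

/-- Summation along the diagonals: `N = k + 2 t u` and `d = n - u`. -/
def diagonalEquiv (M : ℕ) [NeZero M] : Fin M × ((ℤ × ℤ) × ℤ) ≃ (ℤ × ℤ) × ℤ where
  toFun x := ((x.2.2 - x.2.1.1, x.2.1.2), x.1 + M * x.2.1.1)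
  invFun y := ((Int.divModEquiv M y.2).2,
    (((Int.divModEquiv M y.2).1, y.1.2), y.1.1 + (Int.divModEquiv M y.2).1))
  left_inv := by
    rintro ⟨k, ⟨u, v⟩, n⟩
    have h : Int.divModEquiv M ((k : ℤ) + M * u) = (u, k) := by
      rw [← Equiv.eq_symm_apply, Int.divModEquiv_symm_apply]
      ring
    simp [h]
  right_inv := by
    rintro ⟨⟨d, v⟩, N⟩
    have h := (Int.divModEquiv M).symm_apply_apply N
    rw [Int.divModEquiv_symm_apply] at h
    ext
    · simp
    · rfl
    · dsimp only
      linarith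

lemma summable_fintype_prod {ι X : Type*} [Fintype ι] {f : ι × X → ℂ}
    (h : ∀ i, Summable fun x => ‖f (i, x)‖) : Summable f :=
  Summable.of_norm ((summable_prod_of_nonneg fun _ => norm_nonneg _).2
    ⟨h, (hasSum_fintype _).summable⟩)

theorem lemma6p1 (τ : ℂ) (hτ : 0 < τ.im) (t : ℕ) (m l : ℤ) (ht : 2 ≤ t) (hm : 1 ≤ m)
    (hmt : m < (t : ℤ)) :
    (∀ k : ℕ, k < 2 * t →
      Summable (fun x : {x : ℤ × ℤ // x.1 ≡ x.2 [ZMOD 2]} =>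
        thetaTerm τ t ((t : ℤ) + (k : ℤ)) (m + (k : ℤ)) x.1.1 x.1.2) ∧
      Summable (fun r : {r : ℤ // r ≡ 2 * (t : ℤ) * l + (2 * (t : ℤ) - 1) * (k : ℤ)
          [ZMOD 2 * (t : ℤ) * (2 * (t : ℤ) - 1)]} => unaryTerm τ t r.1)) ∧
    ∑ k ∈ Finset.range (2 * t),
        (-1 : ℂ) ^ k * thetaStar τ t ((t : ℤ) + (k : ℤ)) (m + (k : ℤ))
          * unaryTheta τ t (2 * (t : ℤ) * l + (2 * (t : ℤ) - 1) * (k : ℤ))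
      = if l ≡ m [ZMOD 2 * (t : ℤ) - 1] then
          (-1 : ℂ) ^ m * qPow τ (1 / 8) * qPochInf (qPow τ 1) (qPow τ 1) ^ 3
        else if l ≡ -m [ZMOD 2 * (t : ℤ) - 1] then
          (-1 : ℂ) ^ (m + 1) * qPow τ (1 / 8) * qPochInf (qPow τ 1) (qPow τ 1) ^ 3
        else 0 := by
  have ht1 : 1 ≤ t := by omega
  refine ⟨fun k _ => ⟨(summable_norm_thetaTerm hτ ht1 _ _).of_norm.comp_injective
    Subtype.val_injective, (summable_norm_unaryTerm hτ ht1).of_norm.comp_injective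
    Subtype.val_injective⟩, ?_⟩
  have : NeZero (2 * t) := ⟨by omega⟩
  have hθ : ∀ k : Fin (2 * t), Summable fun x : ℤ × ℤ =>
      ‖thetaTerm τ t (t + (k : ℕ)) (m + (k : ℕ)) (x.1 + x.2) (x.1 - x.2)‖ := fun k =>
    (summable_norm_thetaTerm hτ ht1 _ _).comp_injective
      (i := fun x : ℤ × ℤ => (x.1 + x.2, x.1 - x.2))
      (Subtype.val_injective.comp parityPairEquiv.injective)
  have hu : ∀ k : Fin (2 * t), Summable fun n : ℤ =>
      ‖unaryTerm τ t (2 * t * l + (2 * t - 1) * (k : ℕ) + 2 * t * (2 * t - 1) * n)‖ := fun k =>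
    (summable_norm_unaryTerm hτ ht1).comp_injective
      (Subtype.val_injective.comp (residueClassEquiv (2 * t * l + (2 * t - 1) * (k : ℕ))
        (M := 2 * t * (2 * t - 1)) (mul_ne_zero (by omega) (by omega))).injective)
  have hfiber : ∀ (k : Fin (2 * t)) (y : (ℤ × ℤ) × ℤ),
      tripleTerm τ t m l (diagonalEquiv (2 * t) (k, y)) =
      (-1 : ℂ) ^ (k : ℕ) * qPow τ (Cexp t (t + (k : ℕ)) (m + (k : ℕ))) *
      (thetaTerm τ t (t + (k : ℕ)) (m + (k : ℕ)) (y.1.1 + y.1.2) (y.1.1 - y.1.2) *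
        unaryTerm τ t (2 * t * l + (2 * t - 1) * (k : ℕ) + 2 * t * (2 * t - 1) * y.2)) := by
    rintro k ⟨⟨u, v⟩, n⟩
    rw [thetaTerm_mul_unaryTerm ht1 m l k.2]
    simp [diagonalEquiv]
  have hsum : Summable fun x => tripleTerm τ t m l (diagonalEquiv (2 * t) x) := by
    refine summable_fintype_prod fun k => ?_
    simp only [hfiber, norm_mul (_ * _) (thetaTerm _ _ _ _ _ _ * _)]
    exact ((hθ k).mul_norm (hu k)).mul_left _
  have hmain : ∑ k ∈ Finset.range (2 * t),
        (-1 : ℂ) ^ k * thetaStar τ t ((t : ℤ) + (k : ℤ)) (m + (k : ℤ))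
          * unaryTheta τ t (2 * (t : ℤ) * l + (2 * (t : ℤ) - 1) * (k : ℤ)) =
      ∑' x, tripleTerm τ t m l x := by
    rw [← (diagonalEquiv (2 * t)).tsum_eq, hsum.tsum_prod, tsum_fintype, Finset.sum_range]
    refine Finset.sum_congr rfl fun k _ => ?_
    simp only [hfiber]
    rw [tsum_mul_left, ← tsum_mul_tsum_of_summable_norm (hθ k) (hu k), thetaStar, theta_eq_tsum,
      unaryTheta_eq_tsum τ ht1]
    ring
  rw [hmain, tsum_tripleTerm hτ ht1 m l ((diagonalEquiv (2 * t)).summable_iff.1 hsum)]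
  have hiff : l ≡ -m [ZMOD 2 * (t : ℤ) - 1] ↔ 2 * (t : ℤ) - 1 ∣ l + m := by
    rw [Int.modEq_iff_dvd, ← dvd_neg]
    ring_nf
  simp only [hiff]
  simp only [Int.modEq_iff_dvd]
  split_ifs with h1 h2 h2
  · exfalso
    -- Both congruences would make 2t-1 divide 2m, but 0 < 2m < 2t-1.
    have h3 := dvd_add h1 h2
    have h4 := Int.le_of_dvd (by omega) h3
    omega
  all_goals simp
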